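/- Let $m\ge 0$ and $a_1,\dots,a_m\in GF(2)$. For each $n\ge 1$ let $$Q_n : GF(2^n)\to GF(2),\qquad Q_n(x)=\mathrm{Tr}_n\Big(\sum_{i=1}^m a_i x^{2^i+1}\Big),$$ where $\mathrm{Tr}_n$ is the absolute trace of $GF(2^n)$ over $GF(2)$. For each $n\ge 1$ such that $i\le\lfloor (n-1)/2\rfloor$ for every $i$ with $a_i\neq 0$, let $$f_n=\sum_{i=1}^m a_i\,(0,i)_n : GF(2)^n\to GF(2),\qquad (0,i)_n(x_0,\dots,x_{n-1})=\sum_{j=0}^{n-1}x_jx_{j+i}\quad(\text{indices modulo } n)$$ be the corresponding quadratic rotation symmetric Boolean function. A function with values in $GF(2)$ is called balanced if it takes the values $0$ and $1$ equally often. 1. If the number of nonzero $a_i$ is odd, there is an integer $c\ge 1$, depending only on the $a_i$, such that for every $n\ge 1$ the function $Q_n$ is balanced if and only if $n\not\equiv 0 \pmod{2^{c}}$; likewise, for every $n$ for which $f_n$ is defined above, $f_n$ is balanced if and only if $n\not\equiv 0\pmod{2^{c}}$. 2. If the number of nonzero $a_i$ is even, then either none of the functions $Q_n$ ($n\ge1$)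 and none of the functions $f_n$ is balanced, or there is an integer $d\ge 1$, depending only on the $a_i$, such that for every $n\ge 1$ the function $Q_n$ is balanced if and only if $n\equiv 2^{d-1}\pmod{2^{d}}$, and for every $n$ for which $f_n$ is defined above, $f_n$ is balanced if and only if $n\equiv 2^{d-1}\pmod{2^{d}}$. -/

import Mathlib

/-- A `GF(2)`-valued function is balanced when it takes the values `0` and `1` equally often. -/
def IsBalanced {α : Type*} (f : α → ZMod 2) : Prop :=
  Nat.card {x : α // f x = 0} = Nat.card {x : α // f x = 1}

/-- The number of nonzero coefficients among `a 1, …, a m`. -/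
def numTerms (m : ℕ) (a : ℕ → ZMod 2) : ℕ :=
  ((Finset.Icc 1 m).filter (fun i => a i ≠ 0)).card

/-- The monomial rotation symmetric function `(0,i)_n`, generated by the monomial `x_0 x_i`, in the
range `1 ≤ i`, `2 * i < n`, where the `n` rotations `x_j x_{j+i}` (indices modulo `n`) of that
monomial are pairwise distinct. -/
def monomialRS (n : ℕ) [NeZero n] (i : ℕ) (x : ZMod n → ZMod 2) : ZMod 2 :=
  ∑ j : ZMod n, x j * x (j + (i : ZMod n))

/-- The quadratic rotation symmetric function `∑ a_i (0,i)_n` on `GF(2)^n`, `1 ≤ i ≤ m`. -/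
def quadraticRS (m : ℕ) (a : ℕ → ZMod 2) (n : ℕ) [NeZero n] (x : ZMod n → ZMod 2) : ZMod 2 :=
  ∑ i ∈ Finset.Icc 1 m, a i * monomialRS n i x

/-- The trace form `Q_n(x) = Tr_n (∑ a_i x^(2^i+1))` on `GF(2^n)`, `1 ≤ i ≤ m`. -/
noncomputable def quadraticTrace (m : ℕ) (a : ℕ → ZMod 2) (n : ℕ) (x : GaloisField 2 n) : ZMod 2 :=
  Algebra.trace (ZMod 2) (GaloisField 2 n)
    (∑ i ∈ Finset.Icc 1 m, algebraMap (ZMod 2) (GaloisField 2 n) (a i) * x ^ (2 ^ i + 1))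

/-- `(0,i)_n` is defined with `1 ≤ i ≤ ⌊(n-1)/2⌋` for each `i` with `a_i ≠ 0`. -/
def AdmissibleLength (m : ℕ) (a : ℕ → ZMod 2) (n : ℕ) : Prop :=
  ∀ i ∈ Finset.Icc 1 m, a i ≠ 0 → i ≤ (n - 1) / 2

/-!
The rotation symmetric functions and the trace forms are treated together. In both cases there is a
finite commutative `𝔽₂`-algebra `V` (`GF(2^n)`, respectively `GF(2)^n`) with an automorphism `t` (the
Frobenius, respectively the cyclic shift), `t ^ n = 1`, and the trace `tr x = ∑_{j < n} t ^ j x` takes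
values in `𝔽₂` and has a nondegenerate bilinear form; the function is `Q x = tr (x * A x)` with
`A = ∑ a_i t ^ i` (`IsCyclicTrace`).

Put `y = t + t⁻¹ = t⁻¹ (1 + t)²`, a self-adjoint operator, and write `A = α (y) + β (y) t`. The polar
form of `Q` is `tr (x * y β (y) w)`, so the radical of `Q` is the kernel of `y β (y)`, and `Q` is
balanced if and only if it does not vanish identically there (`isBalanced_iff_exists_radical`). Let
`β = Y ^ b u` with `u (0) = 1`, let `k = ∑ a_i = α (0) + β (0)`, and let `n = 2 ^ e r` with `r` odd.

For `x` in the radical, `Q x = α (0) tr x + tr (x q)` with `q = β (y) t x`, and `y q = 0`, that is,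
`t ² q = q`. When `n` is even, `tr (x q)` is therefore computed from the product of `q` and
`S x = ∑_{j < n/2} t ^ (2 j) x`. Up to powers of `t`, the operator `S` is
`y ^ (2 ^ (e-1) - 1) ∑_{j < r} t ^ (2 ^ e j)`, and `y ^ (2 ^ (e-1)) ∑_{j < r} t ^ (2 ^ e j) = 0`.
Comparison of exponents gives (`IsCyclicTrace.quadratic_eq_of_mem_radical`) that on the radical

* `Q = k tr` if `2 ^ e < 2 (b + 1)`,
* `Q = (k + 1) tr` if `2 ^ e = 2 (b + 1)`,
* `Q = 0` if `2 ^ e > 2 (b + 1)`,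

and `tr` does not vanish on the radical in the first two cases
(`IsCyclicTrace.exists_mem_radical_trace_eq_one`). So for odd `k` the function is balanced exactly when
`2 ^ e < 2 (b + 1)`, and for even `k` exactly when `2 ^ e = 2 (b + 1)`. If `β = 0`, all `a_i` vanish.
-/

/-! ### Balance of a quadratic function and its radical -/

/-- The nontrivial character `c ↦ (-1)^c` of `GF(2)`. -/
def signChar (c : ZMod 2) : ℤ := if c = 0 then 1 else -1

lemma signChar_add (a b : ZMod 2) : signChar (a + b) = signChar a * signChar b := by
  revert a b; decide

lemma isBalanced_iff_sum_signChar {V : Type*} [Fintype V] (Q : V → ZMod 2) :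
    IsBalanced Q ↔ ∑ x, signChar (Q x) = 0 := by
  have h : ∀ c : ZMod 2, signChar c = (if c = 0 then 1 else 0) - (if c = 1 then 1 else 0) := by
    decide
  simp only [IsBalanced, h, Finset.sum_sub_distrib, Finset.sum_boole, Nat.card_eq_fintype_card,
    Fintype.card_subtype, sub_eq_zero, Nat.cast_inj]

/-- A character sum over a bilinear form in one variable vanishes off the radical. -/
lemma sum_signChar_eq_zero {V : Type*} [AddCommGroup V] [Fintype V] (B : V → ZMod 2)
    (hB : ∀ x z, B (x + z) = B x + B z) {z : V} (hz : B z ≠ 0) : ∑ x, signChar (B x) = 0 := by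
  have h1 : ∑ x, signChar (B (x + z)) = ∑ x, signChar (B x) :=
    Fintype.sum_equiv (Equiv.addRight z) _ _ fun x => rfl
  have h2 : signChar (B z) = -1 := if_neg hz
  simp only [hB, signChar_add, h2, mul_neg, mul_one, Finset.sum_neg_distrib] at h1
  linarith

/-- A quadratic function over `GF(2)` is balanced exactly when it is not identically zero on the
radical of its polar form. The backward direction translates by a vector of the radical; the
forward direction squares the character sum `∑ (-1)^Q`. -/
theorem isBalanced_iff_exists_radical {V : Type*} [AddCommGroup V] [Finite V] (Q : V → ZMod 2)
    (B : V → V → ZMod 2) (hB : ∀ x z w, B (x + z) w = B x w + B z w)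
    (hQ : ∀ x w, Q (x + w) = Q x + Q w + B x w) :
    IsBalanced Q ↔ ∃ w, (∀ x, B x w = 0) ∧ Q w = 1 := by
  classical
  have := Fintype.ofFinite V
  rw [isBalanced_iff_sum_signChar]
  constructor
  · intro hsum
    by_contra! hrad
    have hQ1 : ∀ c : ZMod 2, c ≠ 1 → c = 0 := by decide
    have hsq : (∑ x, signChar (Q x)) * ∑ x, signChar (Q x)
        = ∑ w, signChar (Q w) * ∑ x, signChar (B x w) := by
      rw [Finset.sum_mul]
      have h1 : ∀ x, signChar (Q x) * ∑ z, signChar (Q z)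
          = ∑ w, signChar (Q w) * signChar (B x w) := by
        intro x
        rw [← Fintype.sum_equiv (Equiv.addLeft x) (fun w => signChar (Q (x + w))) _ fun w => rfl,
          Finset.mul_sum]
        refine Finset.sum_congr rfl fun w _ => ?_
        rw [← signChar_add, ← signChar_add, hQ]
        congr 1
        linear_combination CharTwo.add_self_eq_zero (Q x)
      simp only [h1, Finset.mul_sum]
      exact Finset.sum_comm
    have hterm : ∀ w, signChar (Q w) * ∑ x, signChar (B x w)
        = if ∀ x, B x w = 0 then (Fintype.card V : ℤ) else 0 := by
      intro w
      split_ifs with hw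
      · simp [hw, hQ1 _ (hrad w hw), signChar]
      · push Not at hw
        obtain ⟨z, hz⟩ := hw
        rw [sum_signChar_eq_zero (fun x => B x w) (fun x z => hB x z w) hz, mul_zero]
    have h0 : ∀ x, B x 0 = 0 := by
      intro x
      have h2 := hQ x 0
      have h3 := hQ 0 0
      have h4 := hB 0 0 0
      simp only [add_zero] at h2 h3 h4
      have h5 : B 0 0 = 0 := by simpa using h4
      rw [h5] at h3
      have h6 : Q 0 = 0 := by simpa using h3
      simpa [h6] using h2
    rw [hsum, zero_mul, Finset.sum_congr rfl fun w _ => hterm w] at hsq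
    have h7 : (Fintype.card V : ℤ) ≤ ∑ w, if ∀ x, B x w = 0 then (Fintype.card V : ℤ) else 0 := by
      refine le_trans (le_of_eq (if_pos h0).symm) (Finset.single_le_sum
        (f := fun w => if ∀ x, B x w = 0 then (Fintype.card V : ℤ) else 0) ?_ (Finset.mem_univ 0))
      intro w _
      split_ifs <;> positivity
    have h8 : 0 < Fintype.card V := Fintype.card_pos
    omega
  · rintro ⟨w, hw, hQw⟩
    have h1 : ∑ x, signChar (Q (x + w)) = ∑ x, signChar (Q x) :=
      Fintype.sum_equiv (Equiv.addRight w) _ _ fun x => rfl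
    have h2 : signChar 1 = -1 := by decide
    simp only [hQ, hw, hQw, add_zero, signChar_add, h2, mul_neg, mul_one,
      Finset.sum_neg_distrib] at h1
    linarith

/-! ### Laurent polynomials in `t` in terms of `y = t + t⁻¹` -/

open Polynomial in
/-- The Fibonacci polynomials over `GF(2)`: `t ^ (i + 1) = F i (y) + F (i + 1) (y) * t` whenever
`y = t + t⁻¹`. -/
noncomputable def fibPoly : ℕ → (ZMod 2)[X]
  | 0 => 0
  | 1 => 1
  | i + 2 => X * fibPoly (i + 1) + fibPoly i

open Polynomial in
lemma coeff_fibPoly (i : ℕ) :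
    (fibPoly (i + 1)).coeff i = 1 ∧ (∀ j, i < j → (fibPoly (i + 1)).coeff j = 0) ∧
      ∀ j, i ≤ j → (fibPoly i).coeff j = 0 := by
  induction i with
  | zero =>
    refine ⟨by simp [fibPoly], fun j hj => ?_, fun j _ => by simp [fibPoly]⟩
    simp [fibPoly, coeff_one, hj.ne']
  | succ i ih =>
    obtain ⟨h1, h2, h3⟩ := ih
    have hrec : ∀ j, (fibPoly (i + 1 + 1)).coeff (j + 1)
        = (fibPoly (i + 1)).coeff j + (fibPoly i).coeff (j + 1) := by
      intro j
      rw [fibPoly, coeff_add, coeff_X_mul]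
    refine ⟨by rw [hrec, h1, h3 _ (by omega), add_zero], fun j hj => ?_, fun j hj => h2 j hj⟩
    obtain ⟨j, rfl⟩ : ∃ l, j = l + 1 := ⟨j - 1, by omega⟩
    rw [hrec, h2 _ (by omega), h3 _ (by omega), add_zero]

section Laurent

variable {R : Type*} [CommRing R] [Algebra (ZMod 2) R]

lemma two_eq_zero_of_algebra_zmod (R : Type*) [CommRing R] [Algebra (ZMod 2) R] : (2 : R) = 0 := by
  have h : (2 : ZMod 2) = 0 := by decide
  rw [← map_ofNat (algebraMap (ZMod 2) R) 2, h, map_zero]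

lemma one_add_pow_two_pow_of_algebra_zmod (s : R) (k : ℕ) :
    (1 + s) ^ 2 ^ k = 1 + s ^ 2 ^ k := by
  induction k with
  | zero => simp
  | succ k ih =>
    rw [pow_succ, pow_mul, ih]
    linear_combination s ^ 2 ^ k * two_eq_zero_of_algebra_zmod R

lemma geom_sum_two_pow_of_algebra_zmod (s : R) (k : ℕ) :
    ∑ j ∈ Finset.range (2 ^ k), s ^ j = (1 + s) ^ (2 ^ k - 1) := by
  induction k with
  | zero => simp
  | succ k ih =>
    have h1 : 2 ^ (k + 1) - 1 = 2 ^ k + (2 ^ k - 1) := by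
      have := Nat.one_le_two_pow (n := k)
      omega
    rw [h1, pow_succ, mul_two, Finset.sum_range_add, pow_add,
      one_add_pow_two_pow_of_algebra_zmod, ← ih, one_add_mul, Finset.mul_sum]
    simp only [pow_add]

variable {t t' : R}

lemma pow_succ_eq_fibPoly (h : t * t' = 1) (i : ℕ) :
    t ^ (i + 1) = Polynomial.aeval (t + t') (fibPoly i)
      + Polynomial.aeval (t + t') (fibPoly (i + 1)) * t := by
  induction i with
  | zero => simp [fibPoly]
  | succ i ih =>
    rw [pow_succ, ih, fibPoly, map_add, map_mul, Polynomial.aeval_X]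
    linear_combination (-Polynomial.aeval (t + t') (fibPoly (i + 1))) *
      (h + two_eq_zero_of_algebra_zmod R)

end Laurent

section Laurent

variable {R : Type*} [CommRing R]

lemma geom_sum_range_mul (s : R) (a b : ℕ) :
    ∑ j ∈ Finset.range (a * b), s ^ j
      = (∑ j ∈ Finset.range b, (s ^ a) ^ j) * ∑ j ∈ Finset.range a, s ^ j := by
  induction b with
  | zero => simp
  | succ b ih =>
    rw [mul_add_one, Finset.sum_range_add, ih, Finset.sum_range_succ, add_mul, Finset.mul_sum]
    simp only [pow_add, pow_mul, Finset.mul_sum]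

variable [Algebra (ZMod 2) R]

/-- The part `α` in the decomposition `∑ a_i t ^ i = α (y) + β (y) * t`, `y = t + t⁻¹`. -/
noncomputable def evenPart (m : ℕ) (a : ℕ → ZMod 2) : Polynomial (ZMod 2) :=
  ∑ i ∈ Finset.Icc 1 m, a i • fibPoly (i - 1)

/-- The part `β` in the decomposition `∑ a_i t ^ i = α (y) + β (y) * t`, `y = t + t⁻¹`. -/
noncomputable def oddPart (m : ℕ) (a : ℕ → ZMod 2) : Polynomial (ZMod 2) :=
  ∑ i ∈ Finset.Icc 1 m, a i • fibPoly i

lemma sum_smul_pow_eq_evenPart_add_oddPart {t t' : R} (h : t * t' = 1) (m : ℕ) (a : ℕ → ZMod 2) :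
    ∑ i ∈ Finset.Icc 1 m, a i • t ^ i
      = Polynomial.aeval (t + t') (evenPart m a) + Polynomial.aeval (t + t') (oddPart m a) * t := by
  simp only [evenPart, oddPart, map_sum, map_smul, Finset.sum_mul, ← Finset.sum_add_distrib]
  refine Finset.sum_congr rfl fun i hi => ?_
  obtain ⟨j, rfl⟩ : ∃ j, i = j + 1 := ⟨i - 1, by have := (Finset.mem_Icc.1 hi).1; omega⟩
  rw [pow_succ_eq_fibPoly h, smul_add, smul_mul_assoc, Nat.add_sub_cancel]

/-- Specialization of the decomposition at `t = 1`, where `y = 0`. -/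
lemma coeff_zero_evenPart_add_oddPart (m : ℕ) (a : ℕ → ZMod 2) :
    (evenPart m a).coeff 0 + (oddPart m a).coeff 0 = ∑ i ∈ Finset.Icc 1 m, a i := by
  have h := sum_smul_pow_eq_evenPart_add_oddPart (R := ZMod 2) (t := 1) (t' := 1) (by simp) m a
  have h2 : (1 : ZMod 2) + 1 = 0 := by decide
  simp only [one_pow, smul_eq_mul, mul_one, h2] at h
  rw [h, Polynomial.coe_aeval_eq_eval, ← Polynomial.coeff_zero_eq_eval_zero,
    ← Polynomial.coeff_zero_eq_eval_zero]

/-- The polynomials `fibPoly i`, `1 ≤ i`, have distinct degrees, so they are linearly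
independent. -/
lemma eq_zero_of_oddPart_eq_zero (m : ℕ) (a : ℕ → ZMod 2) (h : oddPart m a = 0) :
    ∀ i ∈ Finset.Icc 1 m, a i = 0 := by
  by_contra! hne
  obtain ⟨i₀, hi₀⟩ := hne
  have hs : ((Finset.Icc 1 m).filter fun i => a i ≠ 0).Nonempty :=
    ⟨i₀, Finset.mem_filter.2 hi₀⟩
  obtain ⟨i, hi, hmax⟩ := Finset.exists_max_image _ id hs
  obtain ⟨hi1, hai⟩ := Finset.mem_filter.1 hi
  obtain ⟨l, rfl⟩ : ∃ l, i = l + 1 := ⟨i - 1, by have := (Finset.mem_Icc.1 hi1).1; omega⟩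
  have hc : (oddPart m a).coeff l = a (l + 1) := by
    rw [oddPart, Polynomial.finsetSum_coeff, Finset.sum_eq_single_of_mem _ hi1]
    · rw [Polynomial.coeff_smul, (coeff_fibPoly l).1, smul_eq_mul, mul_one]
    · intro j hj hjl
      rw [Polynomial.coeff_smul]
      by_cases haj : a j = 0
      · rw [haj, zero_smul]
      · have hle : j ≤ l + 1 := hmax j (Finset.mem_filter.2 ⟨hj, haj⟩)
        rw [(coeff_fibPoly j).2.2 l (by omega), smul_zero]
  rw [h, Polynomial.coeff_zero] at hc
  exact hai hc.symm

end Laurent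

/-! ### Quadratic forms of an automorphism with a trace -/

/-- An `𝔽₂`-algebra `V` on which `t`, an element of a commutative ring `R` acting on `V`, induces a
ring automorphism of order dividing `n`, with the trace `tr x = ∑_{j < n} t ^ j x`, whose values lie
in `𝔽₂` and whose bilinear form `tr (x z)` is nondegenerate. Both `GF(2^n)` with the Frobenius and
`GF(2)^n` with the cyclic shift are of this kind; `R` can be taken to be `𝔽₂[X] / (X ^ n - 1)`. -/
structure IsCyclicTrace {R V : Type*} [CommRing R] [CommRing V] [Algebra (ZMod 2) V] [Module R V]
    (n : ℕ) (t t' : R) (tr : V →ₗ[ZMod 2] ZMod 2) : Prop where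
  mul_inv : t * t' = 1
  pow_eq_one : t ^ n = 1
  smul_mul : ∀ x z : V, t • (x * z) = t • x * t • z
  algebraMap_trace : ∀ x, algebraMap (ZMod 2) V (tr x) = ∑ j ∈ Finset.range n, t ^ j • x
  nondegenerate : ∀ x, (∀ z, tr (x * z) = 0) → x = 0

namespace IsCyclicTrace

variable {R V : Type*} [CommRing R] [CommRing V] [Algebra (ZMod 2) V] [Module R V]
  {n : ℕ} {t t' : R} {tr : V →ₗ[ZMod 2] ZMod 2}

open Polynomial

lemma add_self_eq_zero (V : Type*) [CommRing V] [Algebra (ZMod 2) V] (x : V) : x + x = 0 := by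
  linear_combination x * two_eq_zero_of_algebra_zmod V

lemma pow_smul_mul (h : IsCyclicTrace n t t' tr) (i : ℕ) (x z : V) :
    t ^ i • (x * z) = t ^ i • x * t ^ i • z := by
  induction i with
  | zero => simp
  | succ i ih => simp only [pow_succ', mul_smul, ih, h.smul_mul]

lemma add_inv_mul (h : IsCyclicTrace n t t' tr) : (t + t') * t = 1 + t ^ 2 := by
  linear_combination h.mul_inv

lemma eq_of_pow_smul_eq (h : IsCyclicTrace n t t' tr) (i : ℕ) {x z : V}
    (hxz : t ^ i • x = t ^ i • z) : x = z := by
  have h1 := congrArg (t' ^ i • ·) hxz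
  simpa only [smul_smul, ← mul_pow, mul_comm t', h.mul_inv, one_pow, one_smul] using h1

section Trace

variable [Nontrivial V]

lemma trace_smul (h : IsCyclicTrace n t t' tr) (x : V) : tr (t • x) = tr x := by
  apply (algebraMap (ZMod 2) V).injective
  have h1 := Finset.sum_range_succ (fun j => t ^ j • x) n
  rw [Finset.sum_range_succ', h.pow_eq_one, pow_zero, add_left_inj] at h1
  rw [h.algebraMap_trace, h.algebraMap_trace, ← h1]
  simp only [pow_succ, mul_smul]

lemma trace_pow_smul (h : IsCyclicTrace n t t' tr) (i : ℕ) (x : V) : tr (t ^ i • x) = tr x := by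
  induction i with
  | zero => simp
  | succ i ih => rw [pow_succ', mul_smul, h.trace_smul, ih]

lemma trace_mul_smul (h : IsCyclicTrace n t t' tr) (x z : V) :
    tr (x * t • z) = tr (t' • x * z) := by
  rw [← h.trace_smul (t' • x * z), h.smul_mul, smul_smul, h.mul_inv, one_smul]

lemma trace_mul_inv_smul (h : IsCyclicTrace n t t' tr) (x z : V) :
    tr (x * t' • z) = tr (t • x * z) := by
  rw [mul_comm, ← h.trace_mul_smul, mul_comm]

lemma trace_mul_self (h : IsCyclicTrace n t t' tr) (x : V) : tr (x * x) = tr x := by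
  apply (algebraMap (ZMod 2) V).injective
  have h1 : ∀ s : Finset ℕ, ∑ j ∈ s, t ^ j • (x * x)
      = (∑ j ∈ s, t ^ j • x) * ∑ j ∈ s, t ^ j • x := by
    intro s
    induction s using Finset.induction_on with
    | empty => simp
    | insert i s hi ih =>
      rw [Finset.sum_insert hi, Finset.sum_insert hi, ih, h.pow_smul_mul]
      linear_combination (-(t ^ i • x) * ∑ j ∈ s, t ^ j • x) * two_eq_zero_of_algebra_zmod V
  have h2 : ∀ c : ZMod 2, c * c = c := by decide
  rw [h.algebraMap_trace, h1, ← h.algebraMap_trace, ← map_mul, h2]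

end Trace

/-! ### The kernel of `y = t + t⁻¹` -/

lemma sq_smul_of_mem_ker (h : IsCyclicTrace n t t' tr) {q : V} (hq : (t + t') • q = 0) :
    t ^ 2 • q = q := by
  have h1 : (1 + t ^ 2) • q = 0 := by rw [← h.add_inv_mul, mul_comm, mul_smul, hq, smul_zero]
  rw [add_smul, one_smul] at h1
  linear_combination h1 - add_self_eq_zero V q

lemma pow_two_mul_smul_of_mem_ker (h : IsCyclicTrace n t t' tr) {q : V} (hq : (t + t') • q = 0)
    (i : ℕ) : t ^ (2 * i) • q = q := by
  induction i with
  | zero => simp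
  | succ i ih => rw [mul_add_one, pow_add, mul_smul, h.sq_smul_of_mem_ker hq, ih]

lemma geom_sum_smul_of_mem_ker (h : IsCyclicTrace n t t' tr) {q : V} (hq : (t + t') • q = 0)
    (k : ℕ) {r : ℕ} (hr : Odd r) : (∑ j ∈ Finset.range r, (t ^ 2 ^ (k + 1)) ^ j) • q = q := by
  have h1 : ∀ j, (t ^ 2 ^ (k + 1)) ^ j • q = q := by
    intro j
    rw [← pow_mul, pow_succ', mul_assoc]
    exact h.pow_two_mul_smul_of_mem_ker hq _
  obtain ⟨l, rfl⟩ := hr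
  simp only [Finset.sum_smul, h1, Finset.sum_const, Finset.card_range]
  rw [nsmul_eq_mul]
  push_cast
  linear_combination (l * q) * two_eq_zero_of_algebra_zmod V

/-- For `n = 2 M` the trace is the trace to the fixed ring of `t ^ 2` followed by `z ↦ z + t z`. -/
lemma algebraMap_trace_mul_of_mem_ker (h : IsCyclicTrace n t t' tr) {M : ℕ} (hn : n = 2 * M) {q : V}
    (hq : (t + t') • q = 0) (x : V) :
    algebraMap (ZMod 2) V (tr (x * q))
      = (∑ j ∈ Finset.range M, (t ^ 2) ^ j) • x * q
        + t • ((∑ j ∈ Finset.range M, (t ^ 2) ^ j) • x * q) := by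
  have h1 : (∑ j ∈ Finset.range M, (t ^ 2) ^ j) • x * q
      = (∑ j ∈ Finset.range M, (t ^ 2) ^ j) • (x * q) := by
    simp only [Finset.sum_smul, Finset.sum_mul, ← pow_mul, h.pow_smul_mul,
      h.pow_two_mul_smul_of_mem_ker hq]
  have h2 : ∑ j ∈ Finset.range n, t ^ j = (∑ j ∈ Finset.range M, (t ^ 2) ^ j) * (1 + t) := by
    rw [hn, geom_sum_range_mul]
    simp [Finset.sum_range_succ]
  rw [h1, h.algebraMap_trace, ← Finset.sum_smul, h2, smul_smul, ← add_smul]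
  ring_nf

variable [Algebra (ZMod 2) R]

/-- The operator `∑_{j < r} t ^ (2^e j)`, where `n = 2^e r` with `r` odd, annihilates `y ^ c` as soon
as `2^e ≤ 2 c`, since `y = t⁻¹ (1 + t)²` and `(1 + t) ^ 2^e = 1 + t ^ 2^e`. -/
lemma add_inv_pow_mul_geom_sum (h : IsCyclicTrace n t t' tr) {e r c : ℕ} (hn : n = 2 ^ e * r)
    (hc : 2 ^ e ≤ 2 * c) : (t + t') ^ c * ∑ j ∈ Finset.range r, (t ^ 2 ^ e) ^ j = 0 := by
  have h2 := two_eq_zero_of_algebra_zmod R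
  have h1 : (1 + t ^ 2 ^ e) * ∑ j ∈ Finset.range r, (t ^ 2 ^ e) ^ j = 0 := by
    have h3 := mul_geom_sum (t ^ 2 ^ e) r
    rw [← pow_mul, ← hn, h.pow_eq_one, sub_self] at h3
    linear_combination h3 + (∑ j ∈ Finset.range r, (t ^ 2 ^ e) ^ j) * h2
  have h4 : (t + t') = t' * (1 + t) ^ 2 := by
    linear_combination -(t + 2) * h.mul_inv - h2
  obtain ⟨l, hl⟩ := Nat.exists_eq_add_of_le hc
  rw [h4, mul_pow, ← pow_mul, hl, pow_add, one_add_pow_two_pow_of_algebra_zmod]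
  linear_combination (t' ^ c * (1 + t) ^ l) * h1

variable [IsScalarTower (ZMod 2) R V]

lemma aeval_smul_of_mem_ker {q : V} (hq : (t + t') • q = 0) (p : (ZMod 2)[X]) :
    aeval (t + t') p • q = p.coeff 0 • q := by
  conv_lhs => rw [← divX_mul_X_add p]
  rw [map_add, map_mul, aeval_X, aeval_C, add_smul, mul_smul, hq, smul_zero, zero_add,
    algebraMap_smul]

/-! ### The adjoint and the polar form -/

variable [Nontrivial V]

lemma trace_mul_aeval_smul (h : IsCyclicTrace n t t' tr) (p : (ZMod 2)[X]) (x z : V) :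
    tr (x * aeval (t + t') p • z) = tr (aeval (t + t') p • x * z) := by
  induction p using Polynomial.induction_on generalizing x z with
  | C c => simp only [aeval_C, algebraMap_smul, mul_smul_comm, smul_mul_assoc]
  | add p q hp hq => simp only [map_add, add_smul, mul_add, add_mul, hp, hq]
  | monomial k c ih =>
    rw [pow_succ, ← mul_assoc, map_mul (aeval _), aeval_X, mul_smul, ih, add_smul, mul_add, map_add,
      h.trace_mul_smul, h.trace_mul_inv_smul, ← map_add, ← add_mul, ← add_smul, smul_smul,
      add_comm t' t, mul_comm (aeval _ _)]

/-- Only the constant term of a symmetric operator contributes to its quadratic form: the terms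
`t ^ i + t ^ (-i)`, `i ≠ 0`, give `tr (x * t ^ i x) + tr (x * t ^ (-i) x) = 0`. -/
lemma trace_mul_aeval_smul_self (h : IsCyclicTrace n t t' tr) (p : (ZMod 2)[X]) (x : V) :
    tr (x * aeval (t + t') p • x) = p.coeff 0 * tr x := by
  have h1 : ∀ g : R, (∀ x z : V, tr (x * g • z) = tr (g • x * z)) →
      tr (x * (g * (t + t')) • x) = 0 := by
    intro g hg
    rw [mul_smul, hg, add_smul, mul_add, map_add, h.trace_mul_inv_smul, mul_comm _ x, smul_smul,
      mul_comm t, mul_smul, hg]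
    exact CharTwo.add_self_eq_zero _
  conv_lhs => rw [← divX_mul_X_add p]
  rw [map_add, map_mul (aeval _), aeval_X, aeval_C, add_smul, mul_add, map_add tr,
    h1 _ (h.trace_mul_aeval_smul _), zero_add, algebraMap_smul, mul_smul_comm (p.coeff 0), map_smul,
    h.trace_mul_self, smul_eq_mul]

/-- The polar form of `x ↦ tr (x * (α (y) + β (y) t) x)` is `tr (x * y β (y) w)`. -/
lemma trace_polar (h : IsCyclicTrace n t t' tr) (p q : (ZMod 2)[X]) (x w : V) :
    tr ((x + w) * (aeval (t + t') p + aeval (t + t') q * t) • (x + w))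
      = tr (x * (aeval (t + t') p + aeval (t + t') q * t) • x)
        + tr (w * (aeval (t + t') p + aeval (t + t') q * t) • w)
        + tr (x * aeval (t + t') (X * q) • w) := by
  have h1 : tr (w * (aeval (t + t') p + aeval (t + t') q * t) • x)
      = tr (x * (aeval (t + t') p + aeval (t + t') q * t') • w) := by
    rw [add_smul, mul_add, map_add, h.trace_mul_aeval_smul, mul_smul, h.trace_mul_aeval_smul,
      h.trace_mul_smul, ← map_add, ← add_mul, mul_comm, smul_smul, ← add_smul, mul_comm t']
  have h2 : aeval (t + t') (X * q) = (aeval (t + t') p + aeval (t + t') q * t)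
      + (aeval (t + t') p + aeval (t + t') q * t') := by
    rw [map_mul, aeval_X]
    linear_combination (-aeval (t + t') p) * two_eq_zero_of_algebra_zmod R
  rw [h2, add_smul _ (aeval (t + t') p + aeval (t + t') q * t') w, mul_add x, map_add tr (x * _),
    ← h1, smul_add, add_mul, mul_add, mul_add]
  simp only [map_add]
  ring

end IsCyclicTrace

namespace IsCyclicTrace

open Polynomial

variable {R V : Type*} [CommRing R] [CommRing V] [Algebra (ZMod 2) V] [Module R V]
  {n : ℕ} {t t' : R} {tr : V →ₗ[ZMod 2] ZMod 2} {k r b : ℕ} {u : (ZMod 2)[X]}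

/-! ### The quadratic form on its radical -/

lemma exists_trace_eq_one (h : IsCyclicTrace n t t' tr) [Nontrivial V] : ∃ z, tr z = 1 := by
  by_contra! hz
  have h1 : ∀ c : ZMod 2, c ≠ 1 → c = 0 := by decide
  exact one_ne_zero (h.nondegenerate (1 : V) fun z => h1 _ (hz _))

variable [Algebra (ZMod 2) R]

/-- For `n = 2^(k+1) r`, the sum of the even powers of `t` is, up to a power of `t`, the product of
`∑_{j < r} t ^ (2^(k+1) j)` and `y ^ (2^k - 1)`. -/
lemma geom_sum_sq_eq (h : IsCyclicTrace n t t' tr) (k r : ℕ) :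
    ∑ j ∈ Finset.range (2 ^ k * r), (t ^ 2) ^ j
      = (∑ j ∈ Finset.range r, (t ^ 2 ^ (k + 1)) ^ j) * ((t + t') * t) ^ (2 ^ k - 1) := by
  rw [geom_sum_range_mul, geom_sum_two_pow_of_algebra_zmod, h.add_inv_mul, ← pow_mul, ← pow_succ']

lemma add_inv_mul_geom_sum_sq (h : IsCyclicTrace n t t' tr) (hn : n = 2 ^ (k + 1) * r) :
    (t + t') * ∑ j ∈ Finset.range (2 ^ k * r), (t ^ 2) ^ j = 0 := by
  have h1 : (t + t') * ((t + t') * t) ^ (2 ^ k - 1) = (t + t') ^ 2 ^ k * t ^ (2 ^ k - 1) := by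
    rw [mul_pow, ← mul_assoc, ← pow_succ', Nat.sub_add_cancel Nat.one_le_two_pow]
  have h2 := h.add_inv_pow_mul_geom_sum hn (c := 2 ^ k) (by rw [pow_succ'])
  rw [h.geom_sum_sq_eq, mul_left_comm, h1]
  linear_combination t ^ (2 ^ k - 1) * h2

/-- The radical `y ^ (b+1) u (y) x = 0` in the case `n = 2^(k+1) r`, `r` odd,
`2 (b + 1) > 2^(k+1)`: the vector `q = y ^ b u (y) t x` vanishes. -/
lemma pow_mul_smul_eq_zero (h : IsCyclicTrace n t t' tr) (hn : n = 2 ^ (k + 1) * r) (hr : Odd r)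
    (hb : 2 ^ k ≤ b) {x : V} (hx : aeval (t + t') (X * (X ^ b * u)) • x = 0) :
    (aeval (t + t') (X ^ b * u) * t) • x = 0 := by
  have hq : (t + t') • (aeval (t + t') (X ^ b * u) * t) • x = 0 := by
    rw [map_mul (aeval _) X, aeval_X] at hx
    rw [smul_smul, ← mul_assoc, mul_comm, mul_smul, hx, smul_zero]
  rw [← h.geom_sum_smul_of_mem_ker hq k hr, smul_smul, map_mul, map_pow, aeval_X]
  have h1 := h.add_inv_pow_mul_geom_sum hn (c := b) (by rw [pow_succ']; omega)
  have h2 : (∑ j ∈ Finset.range r, (t ^ 2 ^ (k + 1)) ^ j)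
      * ((t + t') ^ b * aeval (t + t') u * t) = 0 := by
    linear_combination (aeval (t + t') u * t) * h1
  rw [h2, zero_smul]

lemma exists_mem_radical_trace_eq_one (h : IsCyclicTrace n t t' tr) [Nontrivial V] {e : ℕ}
    (hn : n = 2 ^ e * r) (hr : Odd r) (u : (ZMod 2)[X]) (hb : 2 ^ e ≤ 2 * (b + 1)) :
    ∃ x, aeval (t + t') (X * (X ^ b * u)) • x = 0 ∧ tr x = 1 := by
  obtain ⟨z, hz⟩ := h.exists_trace_eq_one
  refine ⟨(∑ j ∈ Finset.range r, (t ^ 2 ^ e) ^ j) • z, ?_, ?_⟩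
  -- The projection of a vector of trace 1 to the kernel of `1 + t ^ 2 ^ e` lies in the radical.
  · have h1 := h.add_inv_pow_mul_geom_sum hn hb
    have h2 : aeval (t + t') (X * (X ^ b * u)) * ∑ j ∈ Finset.range r, (t ^ 2 ^ e) ^ j = 0 := by
      simp only [map_mul, map_pow, aeval_X]
      linear_combination aeval (t + t') u * h1
    rw [smul_smul, h2, zero_smul]
  · obtain ⟨l, rfl⟩ := hr
    simp only [Finset.sum_smul, map_sum, ← pow_mul, h.trace_pow_smul, hz, Finset.sum_const,
      Finset.card_range, nsmul_eq_mul, mul_one]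
    push_cast
    rw [show (2 : ZMod 2) = 0 by decide, zero_mul, zero_add]

variable [IsScalarTower (ZMod 2) R V]

/-- The radical `y ^ (b+1) u (y) x = 0`, `u (0) = 1`, in the case `n = 2^(k+1) r`,
`2 (b + 1) < 2^(k+1)`: the trace to the fixed ring of `t ^ 2` vanishes. -/
lemma geom_sum_sq_smul_eq_zero (h : IsCyclicTrace n t t' tr) (hn : n = 2 ^ (k + 1) * r)
    (hu : u.coeff 0 = 1) (hb : b + 1 < 2 ^ k) {x : V}
    (hx : aeval (t + t') (X * (X ^ b * u)) • x = 0) :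
    (∑ j ∈ Finset.range (2 ^ k * r), (t ^ 2) ^ j) • x = 0 := by
  have h1 : (t + t') • (∑ j ∈ Finset.range (2 ^ k * r), (t ^ 2) ^ j) • x = 0 := by
    rw [smul_smul, h.add_inv_mul_geom_sum_sq hn, zero_smul]
  have h2 := aeval_smul_of_mem_ker h1 u
  rw [hu, one_smul, h.geom_sum_sq_eq] at h2
  obtain ⟨l, hl⟩ : ∃ l, 2 ^ k - 1 = b + 1 + l := Nat.exists_eq_add_of_le (by omega)
  rw [h.geom_sum_sq_eq, ← h2, smul_smul, hl]
  simp only [map_mul, map_pow, aeval_X] at hx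
  have h3 : aeval (t + t') u * ((∑ j ∈ Finset.range r, (t ^ 2 ^ (k + 1)) ^ j)
      * ((t + t') * t) ^ (b + 1 + l)) = (∑ j ∈ Finset.range r, (t ^ 2 ^ (k + 1)) ^ j)
      * (t + t') ^ l * t ^ (b + 1 + l) * ((t + t') * ((t + t') ^ b * aeval (t + t') u)) := by
    rw [mul_pow]
    ring
  rw [h3, mul_smul, hx, smul_zero]

/-- The radical `y ^ (b+1) u (y) x = 0`, `u (0) = 1`, in the case `n = 2^(k+1) r`, `r` odd,
`2 (b + 1) = 2^(k+1)`: up to a power of `t`, the vector `q = y ^ b u (y) t x` is the trace of `x` to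
the fixed ring of `t ^ 2`. -/
lemma pow_smul_eq_geom_sum_sq_smul (h : IsCyclicTrace n t t' tr) (hn : n = 2 ^ (k + 1) * r)
    (hr : Odd r) (hu : u.coeff 0 = 1) (hb : b + 1 = 2 ^ k) {x : V}
    (hx : aeval (t + t') (X * (X ^ b * u)) • x = 0) :
    t ^ b • (aeval (t + t') (X ^ b * u) * t) • x
      = t • (∑ j ∈ Finset.range (2 ^ k * r), (t ^ 2) ^ j) • x := by
  have hq : (t + t') • (aeval (t + t') (X ^ b * u) * t) • x = 0 := by
    rw [map_mul (aeval _) X, aeval_X] at hx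
    rw [smul_smul, ← mul_assoc, mul_comm, mul_smul, hx, smul_zero]
  have h1 : (t + t') • (∑ j ∈ Finset.range (2 ^ k * r), (t ^ 2) ^ j) • x = 0 := by
    rw [smul_smul, h.add_inv_mul_geom_sum_sq hn, zero_smul]
  have h2 := aeval_smul_of_mem_ker h1 u
  rw [hu, one_smul] at h2
  rw [← h.geom_sum_smul_of_mem_ker hq k hr, ← h2, h.geom_sum_sq_eq, map_mul, map_pow, aeval_X,
    show 2 ^ k - 1 = b by omega, mul_pow]
  simp only [smul_smul]
  congr 1
  ring

variable [Nontrivial V]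

lemma trace_aeval_smul (h : IsCyclicTrace n t t' tr) (p : (ZMod 2)[X]) (x : V) :
    tr (aeval (t + t') p • x) = p.coeff 0 * tr x := by
  have h1 : ∀ z : V, tr ((t + t') • z) = 0 := by
    intro z
    have h2 : tr (t' • z) = tr z := by
      rw [← h.trace_smul, smul_smul, h.mul_inv, one_smul]
    rw [add_smul, map_add, h.trace_smul, h2]
    exact CharTwo.add_self_eq_zero _
  conv_lhs => rw [← X_mul_divX_add p]
  rw [map_add, map_mul (aeval _), aeval_X, aeval_C, add_smul, map_add tr, mul_smul, h1, zero_add,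
    algebraMap_smul, map_smul, smul_eq_mul]

/-- The value of `tr (x q)`, `q = β (y) t x`, on the radical `y β (y) x = 0` when `n` is odd: then
`q` is fixed by `t`, hence `q = tr q = β (0) tr x`. -/
lemma trace_mul_of_mem_radical_of_odd (h : IsCyclicTrace n t t' tr) (hn : Odd n) (β : (ZMod 2)[X])
    {x : V} (hx : aeval (t + t') (X * β) • x = 0) :
    tr (x * (aeval (t + t') β * t) • x) = β.coeff 0 * tr x := by
  have hq : (t + t') • (aeval (t + t') β * t) • x = 0 := by
    rw [map_mul, aeval_X] at hx
    rw [smul_smul, ← mul_assoc, mul_comm, mul_smul, hx, smul_zero]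
  have htq : tr ((aeval (t + t') β * t) • x) = β.coeff 0 * tr x := by
    rw [mul_smul, h.trace_aeval_smul, h.trace_smul]
  set q := (aeval (t + t') β * t) • x
  obtain ⟨M, hM⟩ := hn
  have h1 : t • q = q := by
    have h2 : t ^ n • q = q := by rw [h.pow_eq_one, one_smul]
    rwa [hM, pow_succ', mul_smul, h.pow_two_mul_smul_of_mem_ker hq] at h2
  have h3 : ∀ j, t ^ j • q = q := by
    intro j
    induction j with
    | zero => simp
    | succ j ih => rw [pow_succ, mul_smul, h1, ih]
  have h4 : algebraMap (ZMod 2) V (tr q) = q := by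
    rw [h.algebraMap_trace, Finset.sum_congr rfl fun j _ => h3 j, Finset.sum_const,
      Finset.card_range, nsmul_eq_mul, hM]
    push_cast
    linear_combination (M * q) * two_eq_zero_of_algebra_zmod V
  have h5 : ∀ c : ZMod 2, c * c = c := by decide
  rw [← h4, mul_comm, ← Algebra.smul_def, map_smul, smul_eq_mul, htq, mul_assoc, h5]

/-- In the critical case `2 (b + 1) = 2^(k+1)`, let `S` be the trace of `x` to the fixed ring of
`t ^ 2`. Then `q = t S` if `b = 0`, so that `tr (x q) = 2 S (t S) = 0`, and `q = S` otherwise, so that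
`tr (x q) = (S + t S)² = (tr x)²`. -/
lemma trace_mul_of_mem_radical_of_even (h : IsCyclicTrace n t t' tr) (hn : n = 2 ^ (k + 1) * r)
    (hr : Odd r) (hu : u.coeff 0 = 1) (hb : b + 1 = 2 ^ k) {x : V}
    (hx : aeval (t + t') (X * (X ^ b * u)) • x = 0) :
    tr (x * (aeval (t + t') (X ^ b * u) * t) • x) = (1 + (X ^ b * u).coeff 0) * tr x := by
  have hq : (t + t') • (aeval (t + t') (X ^ b * u) * t) • x = 0 := by
    rw [map_mul (aeval _) X, aeval_X] at hx
    rw [smul_smul, ← mul_assoc, mul_comm, mul_smul, hx, smul_zero]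
  have hn2 : n = 2 * (2 ^ k * r) := by rw [hn]; ring
  have hS : (t + t') • (∑ j ∈ Finset.range (2 ^ k * r), (t ^ 2) ^ j) • x = 0 := by
    rw [smul_smul, h.add_inv_mul_geom_sum_sq hn, zero_smul]
  have hqS := h.pow_smul_eq_geom_sum_sq_smul hn hr hu hb hx
  have htr : algebraMap (ZMod 2) V (tr x) = (∑ j ∈ Finset.range (2 ^ k * r), (t ^ 2) ^ j) • x
      + t • (∑ j ∈ Finset.range (2 ^ k * r), (t ^ 2) ^ j) • x := by
    rw [h.algebraMap_trace, ← Finset.sum_smul, hn2, geom_sum_range_mul, smul_smul, ← add_smul]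
    simp only [Finset.sum_range_succ, Finset.sum_range_zero]
    ring_nf
  apply (algebraMap (ZMod 2) V).injective
  rw [h.algebraMap_trace_mul_of_mem_ker hn2 hq]
  set q := (aeval (t + t') (X ^ b * u) * t) • x
  set S := (∑ j ∈ Finset.range (2 ^ k * r), (t ^ 2) ^ j) • x
  clear_value q S
  rcases Nat.eq_zero_or_pos b with rfl | hb0
  · have hc : (X ^ 0 * u).coeff 0 = 1 := by rw [pow_zero, one_mul, hu]
    rw [pow_zero, one_smul] at hqS
    rw [hc, hqS, h.smul_mul, smul_smul, ← pow_two, h.sq_smul_of_mem_ker hS,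
      show (1 + 1 : ZMod 2) = 0 from by decide, zero_mul, map_zero]
    linear_combination (S * t • S) * two_eq_zero_of_algebra_zmod V
  · have hc : (X ^ b * u).coeff 0 = 0 := by
      rw [mul_coeff_zero, coeff_X_pow, if_neg hb0.ne, zero_mul]
    -- Here `2 ^ k > 1`, so `b = 2 ^ k - 1` is odd, and `t ^ b` acts on `q` as `t` does.
    obtain ⟨l, rfl⟩ : ∃ l, b = 2 * l + 1 := by
      cases k with
      | zero => simp at hb; omega
      | succ k => exact ⟨2 ^ k - 1, by rw [pow_succ'] at hb; omega⟩
    rw [pow_succ', mul_smul, h.pow_two_mul_smul_of_mem_ker hq] at hqS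
    have hqS' : q = S := h.eq_of_pow_smul_eq 1 (by rw [pow_one]; exact hqS)
    have h5 : ∀ c : ZMod 2, c * c = c := by decide
    rw [hc, add_zero, one_mul, ← h5 (tr x), map_mul, htr, hqS', h.smul_mul]
    linear_combination (-(S * t • S)) * two_eq_zero_of_algebra_zmod V

/-- On its radical the quadratic form is a multiple of the trace, which depends only on how the
2-part `2 ^ e` of `n` compares with the multiplicity `2 (b + 1)` of `t = 1` as a root of
`y ^ (b+1) u (y)`. -/
theorem quadratic_eq_of_mem_radical (h : IsCyclicTrace n t t' tr) {e : ℕ} (hn : n = 2 ^ e * r)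
    (hr : Odd r) (hu : u.coeff 0 = 1) (α : (ZMod 2)[X]) {x : V}
    (hx : aeval (t + t') (X * (X ^ b * u)) • x = 0) :
    tr (x * (aeval (t + t') α + aeval (t + t') (X ^ b * u) * t) • x)
      = if 2 ^ e < 2 * (b + 1) then (α.coeff 0 + (X ^ b * u).coeff 0) * tr x
        else if 2 ^ e = 2 * (b + 1) then (α.coeff 0 + (X ^ b * u).coeff 0 + 1) * tr x
        else 0 := by
  rw [add_smul, mul_add, map_add, h.trace_mul_aeval_smul_self]
  cases e with
  | zero =>
    rw [if_pos (by rw [pow_zero]; omega), h.trace_mul_of_mem_radical_of_odd (by simpa [hn]) _ hx,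
      add_mul]
  | succ k =>
    rw [pow_succ']
    split_ifs with h1 h2
    · rw [h.pow_mul_smul_eq_zero hn hr (by omega) hx, mul_zero, map_zero, mul_coeff_zero,
        coeff_X_pow, if_neg (by have := Nat.one_le_two_pow (n := k); omega), zero_mul]
      ring
    · rw [h.trace_mul_of_mem_radical_of_even hn hr hu (by omega) hx]
      ring
    · have hn2 : n = 2 * (2 ^ k * r) := by rw [hn]; ring
      have hS := h.geom_sum_sq_smul_eq_zero hn hu (by omega) hx
      have hq : (t + t') • (aeval (t + t') (X ^ b * u) * t) • x = 0 := by
        rw [map_mul (aeval _) X, aeval_X] at hx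
        rw [smul_smul, ← mul_assoc, mul_comm, mul_smul, hx, smul_zero]
      have h3 : tr x = 0 := by
        apply (algebraMap (ZMod 2) V).injective
        rw [h.algebraMap_trace, ← Finset.sum_smul, hn2, geom_sum_range_mul, mul_comm, mul_smul, hS,
          smul_zero, map_zero]
      have h4 : tr (x * (aeval (t + t') (X ^ b * u) * t) • x) = 0 := by
        apply (algebraMap (ZMod 2) V).injective
        rw [h.algebraMap_trace_mul_of_mem_ker hn2 hq, hS]
        simp
      rw [h3, h4, mul_zero, add_zero]

variable [Finite V]

/-- The radical of the polar form is the kernel of `y β (y)`, as the trace form is nondegenerate. -/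
lemma isBalanced_iff_exists (h : IsCyclicTrace n t t' tr) (α β : (ZMod 2)[X]) :
    IsBalanced (fun x : V => tr (x * (aeval (t + t') α + aeval (t + t') β * t) • x)) ↔
      ∃ w : V, aeval (t + t') (X * β) • w = 0 ∧
        tr (w * (aeval (t + t') α + aeval (t + t') β * t) • w) = 1 := by
  rw [isBalanced_iff_exists_radical _ (fun x w => tr (x * aeval (t + t') (X * β) • w))
    (fun x z w => by rw [add_mul, map_add]) (h.trace_polar α β)]
  refine exists_congr fun w => and_congr_left fun _ => ⟨fun hw => ?_, fun hw x => ?_⟩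
  · exact h.nondegenerate _ fun z => by rw [mul_comm, hw]
  · rw [hw, mul_zero, map_zero]

theorem isBalanced_iff (h : IsCyclicTrace n t t' tr) {e : ℕ} (hn : n = 2 ^ e * r) (hr : Odd r)
    (hu : u.coeff 0 = 1) (α : (ZMod 2)[X]) :
    IsBalanced (fun x : V => tr (x * (aeval (t + t') α + aeval (t + t') (X ^ b * u) * t) • x)) ↔
      (α.coeff 0 + (X ^ b * u).coeff 0 = 1 ∧ 2 ^ e < 2 * (b + 1)) ∨
        (α.coeff 0 + (X ^ b * u).coeff 0 = 0 ∧ 2 ^ e = 2 * (b + 1)) := by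
  have hc : ∀ c : ZMod 2, c = 0 ∨ c = 1 := by decide
  have h11 : (1 + 1 : ZMod 2) = 0 := by decide
  rw [h.isBalanced_iff_exists]
  constructor
  · rintro ⟨w, hw, hw1⟩
    rw [h.quadratic_eq_of_mem_radical hn hr hu α hw] at hw1
    split_ifs at hw1 with h1 h2
    · exact Or.inl ⟨(hc _).resolve_left fun h0 => by rw [h0, zero_mul] at hw1; exact zero_ne_one hw1, h1⟩
    · exact Or.inr ⟨(hc _).resolve_right fun h0 => by
        rw [h0, h11, zero_mul] at hw1; exact zero_ne_one hw1, h2⟩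
    · exact absurd hw1 (by decide)
  · intro hcase
    obtain ⟨x, hx, hx1⟩ := h.exists_mem_radical_trace_eq_one hn hr u (b := b) (by omega)
    refine ⟨x, hx, ?_⟩
    rw [h.quadratic_eq_of_mem_radical hn hr hu α hx, hx1]
    rcases hcase with ⟨h0, h1⟩ | ⟨h0, h1⟩
    · rw [if_pos h1, h0, mul_one]
    · rw [if_neg (by omega), if_pos h1, h0, zero_add, mul_one]

end IsCyclicTrace

/-! ### Algebras with an automorphism of finite order -/

open Polynomial in
/-- An algebra endomorphism `σ` with `σ ^ n = 1` makes `V` a module over `𝔽₂[X] / (X ^ n - 1)`. -/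
theorem exists_isCyclicTrace {V : Type} [CommRing V] [Algebra (ZMod 2) V] {n : ℕ} (hn : n ≠ 0)
    (σ : V →ₐ[ZMod 2] V) (hσ : σ ^ n = 1) (tr : V →ₗ[ZMod 2] ZMod 2)
    (htr : ∀ x, algebraMap (ZMod 2) V (tr x) = ∑ j ∈ Finset.range n, (σ ^ j) x)
    (hnd : ∀ x, (∀ z, tr (x * z) = 0) → x = 0) :
    ∃ (R : Type) (_ : CommRing R) (_ : Algebra (ZMod 2) R) (_ : Module R V)
      (_ : IsScalarTower (ZMod 2) R V) (t t' : R),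
      IsCyclicTrace n t t' tr ∧ ∀ (i : ℕ) (x : V), t ^ i • x = (σ ^ i) x := by
  have hpow : ∀ (i : ℕ) (x : V), (σ.toLinearMap ^ i) x = (σ ^ i) x := by
    intro i x
    rw [Module.End.pow_apply, AlgHom.coe_pow, AlgHom.coe_toLinearMap]
  have hker : ∀ p ∈ Ideal.span {(X ^ n - 1 : (ZMod 2)[X])},
      (aeval σ.toLinearMap).toRingHom p = 0 := by
    have h1 : Ideal.span {(X ^ n - 1 : (ZMod 2)[X])}
        ≤ RingHom.ker (aeval (R := ZMod 2) σ.toLinearMap).toRingHom := by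
      rw [Ideal.span_singleton_le_iff_mem, RingHom.mem_ker]
      ext x
      simp [hpow, hσ]
    exact fun p hp => h1 hp
  let ρ := Ideal.Quotient.lift _ _ hker
  let _ : Module ((ZMod 2)[X] ⧸ Ideal.span {(X ^ n - 1 : (ZMod 2)[X])}) V := Module.compHom V ρ
  have hact : ∀ (p : (ZMod 2)[X]) (x : V),
      Ideal.Quotient.mk (Ideal.span {(X ^ n - 1 : (ZMod 2)[X])}) p • x
        = aeval σ.toLinearMap p x := fun p x => rfl
  have hX : ∀ (i : ℕ) (x : V),
      Ideal.Quotient.mk (Ideal.span {(X ^ n - 1 : (ZMod 2)[X])}) X ^ i • x = (σ ^ i) x := by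
    intro i x
    rw [← map_pow, hact, map_pow, aeval_X, hpow]
  have hXn : Ideal.Quotient.mk (Ideal.span {(X ^ n - 1 : (ZMod 2)[X])}) X ^ n = 1 := by
    rw [← map_pow, ← map_one (Ideal.Quotient.mk _), Ideal.Quotient.eq]
    exact Ideal.mem_span_singleton_self _
  refine ⟨(ZMod 2)[X] ⧸ Ideal.span {(X ^ n - 1 : (ZMod 2)[X])}, inferInstance, inferInstance,
    inferInstance, ⟨fun c p x => ?_⟩, Ideal.Quotient.mk _ X, Ideal.Quotient.mk _ X ^ (n - 1),
    ⟨?_, hXn, fun x z => ?_, fun x => ?_, hnd⟩, hX⟩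
  · obtain ⟨p, rfl⟩ := Ideal.Quotient.mk_surjective p
    change Ideal.Quotient.mk _ (c • p) • x = _
    rw [hact, hact, map_smul, LinearMap.smul_apply]
  · rw [← pow_succ', Nat.sub_add_cancel (Nat.one_le_iff_ne_zero.2 hn), hXn]
  · simpa only [pow_one] using
      ((hX 1 (x * z)).trans (map_mul _ x z)).trans (congrArg₂ (· * ·) (hX 1 x) (hX 1 z)).symm
  · simp only [hX, htr]

lemma not_isBalanced_zero {V : Type*} [Finite V] [Nonempty V] {f : V → ZMod 2}
    (hf : ∀ x, f x = 0) : ¬ IsBalanced f := by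
  intro h
  have h1 : IsEmpty {x : V // f x = 1} := ⟨fun x => zero_ne_one ((hf x.1).symm.trans x.2)⟩
  have h2 : Nonempty {x : V // f x = 0} := ⟨⟨Classical.arbitrary V, hf _⟩⟩
  exact Nat.card_pos.ne' (h.trans Nat.card_of_isEmpty)

lemma sum_eq_numTerms (m : ℕ) (a : ℕ → ZMod 2) :
    ∑ i ∈ Finset.Icc 1 m, a i = (numTerms m a : ZMod 2) := by
  have h : ∀ c : ZMod 2, c = if c ≠ 0 then 1 else 0 := by decide
  rw [numTerms, ← Finset.sum_boole]
  exact Finset.sum_congr rfl fun i _ => h _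

open Polynomial in
lemma exists_eq_X_pow_mul_coeff_zero_eq_one {p : (ZMod 2)[X]} (hp : p ≠ 0) :
    ∃ (b : ℕ) (u : (ZMod 2)[X]), p = X ^ b * u ∧ u.coeff 0 = 1 := by
  obtain ⟨u, hu, hdvd⟩ := p.exists_eq_pow_rootMultiplicity_mul_and_not_dvd hp 0
  have h1 : ∀ c : ZMod 2, c ≠ 0 → c = 1 := by decide
  rw [C_0, sub_zero] at hu hdvd
  exact ⟨_, u, hu, h1 _ fun h0 => hdvd (X_dvd_iff.2 h0)⟩

/-- The balancedness criterion for all algebras with an automorphism and trace at once: it involves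
the coefficients only through their number modulo 2 and the integer `b`, and `n` only through its
2-part. The number `b` is the multiplicity of `0` as a root of `oddPart m a`. -/
theorem exists_isBalanced_trace_iff (m : ℕ) (a : ℕ → ZMod 2)
    (ha : ¬ ∀ i ∈ Finset.Icc 1 m, a i = 0) :
    ∃ b : ℕ, ∀ (V : Type) [CommRing V] [Nontrivial V] [Finite V] [Algebra (ZMod 2) V] (e r : ℕ)
      (_ : Odd r) (σ : V →ₐ[ZMod 2] V) (_ : σ ^ (2 ^ e * r) = 1) (tr : V →ₗ[ZMod 2] ZMod 2)
      (_ : ∀ x, algebraMap (ZMod 2) V (tr x) = ∑ j ∈ Finset.range (2 ^ e * r), (σ ^ j) x)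
      (_ : ∀ x, (∀ z, tr (x * z) = 0) → x = 0),
      (IsBalanced (fun x => tr (x * ∑ i ∈ Finset.Icc 1 m, a i • (σ ^ i) x)) ↔
        (Odd (numTerms m a) ∧ 2 ^ e < 2 * (b + 1)) ∨
          (Even (numTerms m a) ∧ 2 ^ e = 2 * (b + 1))) := by
  obtain ⟨b, u, hb, hu⟩ :=
    exists_eq_X_pow_mul_coeff_zero_eq_one fun h => ha (eq_zero_of_oddPart_eq_zero m a h)
  refine ⟨b, fun V _ _ _ _ e r hr σ hσ tr htr hnd => ?_⟩
  have hn : 2 ^ e * r ≠ 0 := mul_ne_zero (by positivity) hr.pos.ne'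
  obtain ⟨R, _, _, _, _, t, t', h, hpow⟩ := exists_isCyclicTrace hn σ hσ tr htr hnd
  have h1 := h.isBalanced_iff rfl hr hu (evenPart m a) (b := b)
  rw [← hb, ← sum_smul_pow_eq_evenPart_add_oddPart h.mul_inv, coeff_zero_evenPart_add_oddPart,
    sum_eq_numTerms, ZMod.natCast_eq_one_iff_odd, ZMod.natCast_eq_zero_iff_even] at h1
  simpa only [Finset.sum_smul, smul_assoc, hpow] using h1

/-! ### The trace forms and the rotation symmetric functions -/

/-- The criterion of `exists_isBalanced_trace_iff` for the Frobenius of `GF(2^n)` and for the shift of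
`GF(2)^n`, with the same `b`. -/
theorem exists_isBalanced_iff (m : ℕ) (a : ℕ → ZMod 2) (ha : ¬ ∀ i ∈ Finset.Icc 1 m, a i = 0) :
    ∃ b : ℕ, ∀ (e r : ℕ) (_ : Odd r),
      (IsBalanced (quadraticTrace m a (2 ^ e * r)) ↔
        (Odd (numTerms m a) ∧ 2 ^ e < 2 * (b + 1)) ∨
          (Even (numTerms m a) ∧ 2 ^ e = 2 * (b + 1))) ∧
      ∀ [NeZero (2 ^ e * r)], (IsBalanced (quadraticRS m a (2 ^ e * r)) ↔
        (Odd (numTerms m a) ∧ 2 ^ e < 2 * (b + 1)) ∨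
          (Even (numTerms m a) ∧ 2 ^ e = 2 * (b + 1))) := by
  obtain ⟨b, hb⟩ := exists_isBalanced_trace_iff m a ha
  refine ⟨b, fun e r hr => ⟨?_, fun {_} => ?_⟩⟩
  · have hn : 2 ^ e * r ≠ 0 := mul_ne_zero (by positivity) hr.pos.ne'
    have hfin : Finite (GaloisField 2 (2 ^ e * r)) := inferInstance
    have := Fintype.ofFinite (GaloisField 2 (2 ^ e * r))
    have hpow : ∀ (i : ℕ) (x : GaloisField 2 (2 ^ e * r)),
        (FiniteField.frobeniusAlgHom (ZMod 2) (GaloisField 2 (2 ^ e * r)) ^ i) x = x ^ 2 ^ i := by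
      intro i x
      rw [AlgHom.coe_pow, FiniteField.coe_frobeniusAlgHom, pow_iterate, ZMod.card]
    rw [← hb (GaloisField 2 (2 ^ e * r)) e r hr (FiniteField.frobeniusAlgHom (ZMod 2) _) ?_
      (Algebra.trace (ZMod 2) _) ?_ ?_]
    · refine iff_of_eq (congrArg IsBalanced (funext fun x => ?_))
      rw [quadraticTrace, Finset.mul_sum]
      refine congrArg _ (Finset.sum_congr rfl fun i _ => ?_)
      rw [hpow, Algebra.smul_def]
      ring
    · ext x
      rw [hpow, ← GaloisField.card 2 _ hn, Nat.card_eq_fintype_card, FiniteField.pow_card,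
        AlgHom.one_apply]
    · intro x
      rw [FiniteField.algebraMap_trace_eq_sum_pow, GaloisField.finrank 2 hn, Nat.card_zmod]
      simp only [hpow]
    · intro x hx
      exact (traceForm_nondegenerate (ZMod 2) (GaloisField 2 (2 ^ e * r))).1 x hx
  · let σ : (ZMod (2 ^ e * r) → ZMod 2) →ₐ[ZMod 2] (ZMod (2 ^ e * r) → ZMod 2) :=
      { toFun := fun x j => x (j + 1)
        map_one' := rfl
        map_mul' := fun _ _ => rfl
        map_zero' := rfl
        map_add' := fun _ _ => rfl
        commutes' := fun _ => rfl }
    have hpow : ∀ (i : ℕ) (x : ZMod (2 ^ e * r) → ZMod 2) (j : ZMod (2 ^ e * r)),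
        (σ ^ i) x j = x (j + i) := by
      intro i
      induction i with
      | zero => simp
      | succ i ih =>
        intro x j
        rw [pow_succ', AlgHom.mul_apply]
        change (σ ^ i) x (j + 1) = _
        rw [ih]
        push_cast
        ring_nf
    have htr : ∀ x : ZMod (2 ^ e * r) → ZMod 2,
        (∑ j, LinearMap.proj j : (ZMod (2 ^ e * r) → ZMod 2) →ₗ[ZMod 2] ZMod 2) x = ∑ j, x j := by
      intro x
      simp
    rw [← hb (ZMod (2 ^ e * r) → ZMod 2) e r hr σ ?_ (∑ j, LinearMap.proj j) ?_ ?_]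
    · refine iff_of_eq (congrArg IsBalanced (funext fun x => ?_))
      rw [htr, quadraticRS]
      simp only [monomialRS, Pi.mul_apply, Finset.sum_apply, Pi.smul_apply, hpow, Finset.mul_sum,
        smul_eq_mul]
      rw [Finset.sum_comm]
      refine Finset.sum_congr rfl fun j _ => Finset.sum_congr rfl fun i _ => ?_
      ring
    · ext x j
      rw [hpow, ZMod.natCast_self, add_zero, AlgHom.one_apply]
    · intro x
      ext j
      rw [htr, Finset.sum_apply]
      simp only [hpow]
      change ∑ l, x l = _
      rw [← Equiv.sum_comp (Equiv.addLeft j) x, Finset.sum_range]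
      refine (Fintype.sum_bijective (fun i : Fin (2 ^ e * r) => ((i : ℕ) : ZMod (2 ^ e * r))) ?_ _ _
        fun i => rfl).symm
      rw [Fintype.bijective_iff_injective_and_card]
      refine ⟨fun i l hil => Fin.ext ?_, by rw [Fintype.card_fin, ZMod.card]⟩
      exact Nat.ModEq.eq_of_lt_of_lt ((ZMod.natCast_eq_natCast_iff _ _ _).1 hil) i.2 l.2
    · intro x hx
      ext j
      have h1 := hx (Pi.single j 1)
      rw [htr, Finset.sum_eq_single j] at h1
      · simpa using h1
      · intro l _ hl
        simp [hl]
      · simp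

/-! ### Congruence conditions on the length -/

lemma two_pow_mul_odd_modEq_zero_iff {e r : ℕ} (hr : Odd r) (c : ℕ) :
    2 ^ e * r ≡ 0 [MOD 2 ^ c] ↔ c ≤ e := by
  rw [Nat.modEq_zero_iff_dvd,
    (Nat.Coprime.pow_left c (Nat.coprime_two_left.2 hr)).dvd_mul_right,
    Nat.pow_dvd_pow_iff_le_right one_lt_two]

lemma two_pow_mul_odd_modEq_two_pow_iff {e r : ℕ} (hr : Odd r) (c : ℕ) :
    2 ^ e * r ≡ 2 ^ c [MOD 2 ^ (c + 1)] ↔ 2 ^ e = 2 ^ c := by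
  rw [Nat.pow_right_inj one_lt_two]
  constructor
  · intro h
    have h1 : 2 ^ e * r ≡ 0 [MOD 2 ^ c] :=
      (h.of_dvd (pow_dvd_pow 2 c.le_succ)).trans (Nat.modEq_zero_iff_dvd.2 dvd_rfl)
    have h2 : ¬ 2 ^ e * r ≡ 0 [MOD 2 ^ (c + 1)] := fun h3 => by
      have h4 := Nat.modEq_zero_iff_dvd.1 (h.symm.trans h3)
      exact absurd ((Nat.pow_dvd_pow_iff_le_right one_lt_two).1 h4) (by omega)
    rw [two_pow_mul_odd_modEq_zero_iff hr] at h1 h2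
    omega
  · rintro rfl
    obtain ⟨l, rfl⟩ := hr
    have h1 : 2 ^ e * (2 * l + 1) = 2 ^ e + 2 ^ (e + 1) * l := by ring
    rw [h1]
    exact Nat.ModEq.symm (Nat.modEq_of_dvd (by simp))

theorem mainTheorem1 (m : ℕ) (a : ℕ → ZMod 2) :
    (Odd (numTerms m a) →
      ∃ c : ℕ, 1 ≤ c ∧
        (∀ n : ℕ, 1 ≤ n →
          (IsBalanced (quadraticTrace m a n) ↔ ¬ n ≡ 0 [MOD 2 ^ c])) ∧
        (∀ (n : ℕ) [NeZero n], AdmissibleLength m a n →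
          (IsBalanced (quadraticRS m a n) ↔ ¬ n ≡ 0 [MOD 2 ^ c]))) ∧
    (Even (numTerms m a) →
      ((∀ n : ℕ, 1 ≤ n → ¬ IsBalanced (quadraticTrace m a n)) ∧
        (∀ (n : ℕ) [NeZero n], AdmissibleLength m a n → ¬ IsBalanced (quadraticRS m a n))) ∨
      ∃ d : ℕ, 1 ≤ d ∧
        (∀ n : ℕ, 1 ≤ n →
          (IsBalanced (quadraticTrace m a n) ↔ n ≡ 2 ^ (d - 1) [MOD 2 ^ d])) ∧
        (∀ (n : ℕ) [NeZero n], AdmissibleLength m a n →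
          (IsBalanced (quadraticRS m a n) ↔ n ≡ 2 ^ (d - 1) [MOD 2 ^ d]))) := by
  by_cases ha : ∀ i ∈ Finset.Icc 1 m, a i = 0
  · have hnum : numTerms m a = 0 := by
      rw [numTerms, Finset.card_eq_zero, Finset.filter_eq_empty_iff]
      exact fun i hi => not_not.2 (ha i hi)
    refine ⟨fun hodd => absurd hodd (by rw [hnum]; decide), fun _ => Or.inl ⟨fun n hn => ?_,
      fun n _ _ => not_isBalanced_zero fun x => ?_⟩⟩
    · have hfin : Finite (GaloisField 2 n) := inferInstance
      refine not_isBalanced_zero fun x => ?_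
      rw [quadraticTrace, Finset.sum_eq_zero fun i hi => by rw [ha i hi, map_zero, zero_mul],
        map_zero]
    · exact Finset.sum_eq_zero fun i hi => by rw [ha i hi, zero_mul]
  obtain ⟨b, hb⟩ := exists_isBalanced_iff m a ha
  refine ⟨fun hodd => ?_, fun heven => ?_⟩
  · have hne : ¬ Even (numTerms m a) := Nat.not_even_iff_odd.2 hodd
    have hiff : ∀ {e r : ℕ}, Odd r → ((Odd (numTerms m a) ∧ 2 ^ e < 2 * (b + 1)) ∨
        (Even (numTerms m a) ∧ 2 ^ e = 2 * (b + 1)) ↔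
          ¬ 2 ^ e * r ≡ 0 [MOD 2 ^ Nat.clog 2 (2 * (b + 1))]) := by
      intro e r hr
      rw [two_pow_mul_odd_modEq_zero_iff hr, not_le, Nat.lt_clog_iff_pow_lt one_lt_two]
      simp [hodd, hne]
    refine ⟨Nat.clog 2 (2 * (b + 1)), Nat.clog_pos one_lt_two (by omega), fun n hn => ?_,
      fun n _ _ => ?_⟩
    · obtain ⟨e, r, hr, rfl⟩ := Nat.exists_eq_two_pow_mul_odd (Nat.one_le_iff_ne_zero.1 hn)
      rw [(hb e r hr).1, hiff hr]
    · obtain ⟨e, r, hr, rfl⟩ := Nat.exists_eq_two_pow_mul_odd (NeZero.ne n)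
      rw [(hb e r hr).2, hiff hr]
  · have hno : ¬ Odd (numTerms m a) := Nat.not_odd_iff_even.2 heven
    have hiff : ∀ {e : ℕ}, ((Odd (numTerms m a) ∧ 2 ^ e < 2 * (b + 1)) ∨
        (Even (numTerms m a) ∧ 2 ^ e = 2 * (b + 1)) ↔ 2 ^ e = 2 * (b + 1)) := by
      simp [heven, hno]
    by_cases hpow : ∃ c, 2 ^ c = 2 * (b + 1)
    · obtain ⟨c, hc⟩ := hpow
      refine Or.inr ⟨c + 1, by omega, fun n hn => ?_, fun n _ _ => ?_⟩
      · obtain ⟨e, r, hr, rfl⟩ := Nat.exists_eq_two_pow_mul_odd (Nat.one_le_iff_ne_zero.1 hn)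
        rw [(hb e r hr).1, hiff, ← hc, Nat.add_sub_cancel, two_pow_mul_odd_modEq_two_pow_iff hr]
      · obtain ⟨e, r, hr, rfl⟩ := Nat.exists_eq_two_pow_mul_odd (NeZero.ne n)
        rw [(hb e r hr).2, hiff, ← hc, Nat.add_sub_cancel, two_pow_mul_odd_modEq_two_pow_iff hr]
    · refine Or.inl ⟨fun n hn => ?_, fun n _ _ => ?_⟩
      · obtain ⟨e, r, hr, rfl⟩ := Nat.exists_eq_two_pow_mul_odd (Nat.one_le_iff_ne_zero.1 hn)
        rw [(hb e r hr).1, hiff]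
        exact fun h => hpow ⟨e, h⟩
      · obtain ⟨e, r, hr, rfl⟩ := Nat.exists_eq_two_pow_mul_odd (NeZero.ne n)
        rw [(hb e r hr).2, hiff]
        exact fun h => hpow ⟨e, h⟩
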